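/- Let $C_2=\prod_{p\ge 3}\bigl(1-\frac1{(p-1)^2}\bigr)$ (product over primes $p\ge 3$) be the twin prime constant, and for a nonzero even integer $d$ let $$\mathfrak S(d)=2C_2\prod_{\substack{p\mid d\\ p>2}}\Bigl(1+\frac1{p-2}\Bigr),$$ the product being over primes $p$. For a sufficiently large positive integer $N$ put $K=K(N)=\lfloor \log_2 N-2\log_2(\log N)\rfloor$ and $$\Phi(N)=\frac1{K^2}\sum_{\substack{1\le h\le K-1\\ h\text{ even}}}\ \sum_{1\le k_2\le K-h}\mathfrak S\bigl(2^{k_2}(2^h-1)-h\bigr).$$ Let $g$ be the multiplicative function supported on the odd squarefree positive integers with $g(p)=\frac1{p-2}$ for every odd prime $p$, let $\mathrm{ord}_\beta(2)$ be the multiplicative order of $2$ modulo $\beta$ (so $\mathrm{ord}_1(2)=1$), and let $$C_{\mathrm{Rom}}=\sum_{\substack{\beta\ge 1\\ 2\nmid\beta}}\frac{\mu^2(\beta)g(\beta)}{\mathrm{ord}_\beta(2)},$$ where $\mu$ is the Möbius function. Then the series $C_{\mathrm{Rom}}$ converges, and $$\frac12\le\liminf_{N\to\infty}\Phi(N)\le\limsup_{N\to\infty}\Phi(N)\le\frac12\bigl(C_{\mathrm{Rom}}+e^{\gamma}\log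 2\bigr),$$ where $\gamma$ is Euler's constant. -/

import Mathlib

open Filter
open scoped Topology

noncomputable section

/-- The twin prime constant `C₂ = ∏_{p ≥ 3} (1 - 1/(p-1)²)`, the product over the primes `p ≥ 3`. -/
def twinPrimeConst : ℝ :=
  ∏' p : {p : ℕ // p.Prime ∧ 3 ≤ p}, (1 - 1 / ((p : ℝ) - 1) ^ 2)

/-- The infinite product defining the twin prime constant converges, so that the value of
`twinPrimeConst` is not the default value of `∏'`. -/
theorem multipliable_twinPrimeConst :
    Multipliable fun p : {p : ℕ // p.Prime ∧ 3 ≤ p} => (1 - 1 / ((p : ℝ) - 1) ^ 2) := by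
  have h1 : Summable fun n : ℕ => 4 * (1 / (n : ℝ) ^ 2) :=
    (Real.summable_one_div_nat_pow.mpr (by norm_num)).mul_left 4
  have h2 : Summable fun p : {p : ℕ // p.Prime ∧ 3 ≤ p} => 4 * (1 / ((p : ℕ) : ℝ) ^ 2) :=
    h1.comp_injective Subtype.val_injective
  have h3 : Summable fun p : {p : ℕ // p.Prime ∧ 3 ≤ p} => ‖-(1 / ((p : ℝ) - 1) ^ 2)‖ := by
    refine Summable.of_nonneg_of_le (fun _ => norm_nonneg _) (fun p => ?_) h2
    have hp : (3 : ℝ) ≤ ((p : ℕ) : ℝ) := by exact_mod_cast p.2.2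
    rw [norm_neg, Real.norm_of_nonneg (by positivity), mul_one_div,
      div_le_div_iff₀ (by nlinarith) (by nlinarith)]
    nlinarith
  simpa [sub_eq_add_neg] using multipliable_one_add_of_summable h3

/-- The singular series `𝔖(d) = 2 C₂ ∏_{p ∣ d, p > 2} (1 + 1/(p-2))`, used for nonzero even `d`. -/
def singularSeries (d : ℤ) : ℝ :=
  2 * twinPrimeConst * ∏ p ∈ d.natAbs.primeFactors with 2 < p, (1 + 1 / ((p : ℝ) - 2))

/-- `K(N) = ⌊log₂ N - 2 log₂ (log N)⌋`. (Where the real number is negative, which does not happen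
for large `N`, this is `0`.) -/
def paramK (N : ℕ) : ℕ :=
  ⌊Real.logb 2 N - 2 * Real.logb 2 (Real.log N)⌋₊

/-- `d(k₂, h) = 2^{k₂} (2^h - 1) - h`. -/
def diffD (k₂ h : ℕ) : ℤ :=
  2 ^ k₂ * (2 ^ h - 1) - h

/-- The mean value
`Φ(N) = K⁻² ∑_{1 ≤ h ≤ K-1, h even} ∑_{1 ≤ k₂ ≤ K-h} 𝔖(d(k₂, h))` with `K = K(N)`. -/
def meanPhi (N : ℕ) : ℝ :=
  1 / (paramK N : ℝ) ^ 2 *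
    ∑ h ∈ Finset.Icc 1 (paramK N - 1) with Even h,
      ∑ k₂ ∈ Finset.Icc 1 (paramK N - h), singularSeries (diffD k₂ h)

/-- The multiplicative function supported on the odd squarefree integers with
`g(p) = 1/(p-2)` for odd primes `p`. -/
def gFun (n : ℕ) : ℝ :=
  open Classical in
  if Odd n ∧ Squarefree n then ∏ p ∈ n.primeFactors, 1 / ((p : ℝ) - 2) else 0

/-- The term `μ²(β) g(β) / ord_β(2)`, for odd `β`, of the Romanov series, and `0` for even `β`. -/
def romanovTerm (β : ℕ) : ℝ :=
  if Odd β then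
    (ArithmeticFunction.moebius β : ℝ) ^ 2 * gFun β / (orderOf (2 : ZMod β) : ℝ)
  else 0

/-- The Romanov-type constant `C_Rom = ∑_{2 ∤ β} μ²(β) g(β) / ord_β(2)`. -/
def romanovConst : ℝ :=
  ∑' β : ℕ, romanovTerm β

end

/-!
The mean value `meanPhi N` in fact tends to `1/2`, the mean that the singular series would have if
the numbers `d = diffD k₂ h` were equidistributed modulo every odd squarefree number. This gives the
lower bound, and also the upper bound, because the term `β = 1` already shows `romanovConst ≥ 1`.

Write `g(p) = 1/(p-2)`, so that `𝔖(d) = 2 C₂ ∏_{p ∣ d, p > 2} (1 + g(p))`, and let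
`smoothProd y d` be the part of the product over the primes `p < y`.

*Small primes.* For fixed `y` and `k`, the mean of `smoothProd y (diffD k (2 m))` over `m` is exactly
`∏_{2 < p < y} (1 + g(p)/p)` (`exists_abs_sum_smoothProd_sub_le`). Indeed, given the contribution of
the primes below `p`, which is periodic in `m` with period `(p-1)!`, shifts of `m` by multiples of
this period fix `2 ^ (2 m)` modulo `p` and run `2 m` through all residues modulo `p`, so that `p ∣ d`
has conditional density `1/p`. As `y → ∞`, the product tends to `1/C₂`, and there are about `K²/4`
pairs `(h, k₂)`; hence the limit `2 C₂ · (1/4) · (1/C₂) = 1/2`.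

*Medium primes.* Grouping the divisors of `d` by their largest prime factor bounds
`smoothProd K d - smoothProd y d` by the sum of `g(p) ∏_{2 < q < p} (1 + g(q))` over the primes
`y ≤ p < K` dividing `d` (`smoothProd_le_add_sum`). Since `p ∣ d` holds for at most `3 K² / ord_p(2)`
pairs, the average of this is at most three times a tail of the series of
`romanovWeight p = g(p) ∏_{2 < q < p} (1 + g(q)) / ord_p(2)`. The same grouping applied to the
Romanov series, with `ord_β(2) ≥ ord_p(2)` for the largest prime factor `p` of `β`, bounds it by
`1 + ∑ romanovWeight p`. So both the tail estimate and the convergence of the Romanov series come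
from `summable_romanovWeight`, which rests on the bound `∏_{2 < q < p} (1 + g(q)) ≪ p ^ (2/5)` and on
the fact that at most `t` primes satisfy `ord_p(2) = t`.

*Large primes.* As `0 < d < 2 ^ K`, at most `K log 2 / log K` primes `p ≥ K` divide `d`, and together
they contribute a factor `1 + o(1)` (`oddFactorProd_le`).
-/

/-! ### Products over odd primes -/

/-- The odd primes `p < n`. -/
def oddPrimesBelow (n : ℕ) : Finset ℕ := {p ∈ Finset.range n | p.Prime ∧ 2 < p}

theorem mem_oddPrimesBelow {n p : ℕ} : p ∈ oddPrimesBelow n ↔ p < n ∧ p.Prime ∧ 2 < p := by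
  simp [oddPrimesBelow]

theorem oddPrimesBelow_succ_of_prime {n : ℕ} (hn : n.Prime ∧ 2 < n) :
    oddPrimesBelow (n + 1) = insert n (oddPrimesBelow n) := by
  rw [oddPrimesBelow, Finset.range_add_one, Finset.filter_insert, if_pos hn]
  rfl

theorem oddPrimesBelow_succ_of_not_prime {n : ℕ} (hn : ¬ (n.Prime ∧ 2 < n)) :
    oddPrimesBelow (n + 1) = oddPrimesBelow n := by
  rw [oddPrimesBelow, Finset.range_add_one, Finset.filter_insert, if_neg hn]
  rfl

theorem self_notMem_oddPrimesBelow (n : ℕ) : n ∉ oddPrimesBelow n := by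
  simp [mem_oddPrimesBelow]

theorem one_div_sub_two_pos {p : ℕ} (hp : 2 < p) : 0 < 1 / ((p : ℝ) - 2) := by
  have : (2 : ℝ) < p := by exact_mod_cast hp
  exact one_div_pos.mpr (by linarith)

/-- The product `∏_{2 < p < n} (1 + 1/(p-2))` over primes. -/
noncomputable def primeProd (n : ℕ) : ℝ := ∏ p ∈ oddPrimesBelow n, (1 + 1 / ((p : ℝ) - 2))

theorem primeProd_succ_of_prime {n : ℕ} (hn : n.Prime ∧ 2 < n) :
    primeProd (n + 1) = (1 + 1 / ((n : ℝ) - 2)) * primeProd n := by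
  rw [primeProd, oddPrimesBelow_succ_of_prime hn,
    Finset.prod_insert (self_notMem_oddPrimesBelow n), primeProd]

theorem primeProd_succ_of_not_prime {n : ℕ} (hn : ¬ (n.Prime ∧ 2 < n)) :
    primeProd (n + 1) = primeProd n := by
  rw [primeProd, oddPrimesBelow_succ_of_not_prime hn, primeProd]

theorem one_le_primeProd (n : ℕ) : 1 ≤ primeProd n := by
  refine Finset.one_le_prod (fun p hp => ?_)
  have := one_div_sub_two_pos (mem_oddPrimesBelow.1 hp).2.2
  linarith

theorem primeProd_pos (n : ℕ) : 0 < primeProd n := zero_lt_one.trans_le (one_le_primeProd n)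

theorem primeProd_le_succ (n : ℕ) : primeProd n ≤ primeProd (n + 1) := by
  by_cases hn : n.Prime ∧ 2 < n
  · rw [primeProd_succ_of_prime hn]
    have := one_div_sub_two_pos hn.2
    nlinarith [primeProd_pos n]
  · rw [primeProd_succ_of_not_prime hn]

theorem primeProd_mono : Monotone primeProd := monotone_nat_of_le_succ primeProd_le_succ

theorem primeProd_succ_le {n : ℕ} (hn : 2 < n) :
    primeProd (n + 1) ≤ (1 + 1 / ((n : ℝ) - 2)) * primeProd n := by
  by_cases h : n.Prime
  · rw [primeProd_succ_of_prime ⟨h, hn⟩]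
  · rw [primeProd_succ_of_not_prime (fun h' => h h'.1)]
    have := one_div_sub_two_pos hn
    nlinarith [primeProd_pos n]

theorem not_prime_of_dvd_of_lt {n d : ℕ} (hd : d ∣ n) (h1 : d ≠ 1) (hlt : d < n) : ¬ n.Prime :=
  fun h => by rcases h.eq_one_or_self_of_dvd d hd with h | h <;> omega

/-- Only two of six consecutive integers are coprime to `6`, so six steps multiply `primeProd` by
at most two factors. -/
theorem primeProd_add_six_le (k : ℕ) :
    primeProd (6 * (k + 1) + 6) ≤ (1 + 1 / (6 * (k : ℝ) + 5)) ^ 2 * primeProd (6 * k + 6) := by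
  have e0 : primeProd (6 * k + 6 + 1) = primeProd (6 * k + 6) :=
    primeProd_succ_of_not_prime fun h =>
      not_prime_of_dvd_of_lt (d := 2) (by omega) (by omega) (by omega) h.1
  have e1 := primeProd_succ_le (n := 6 * k + 7) (by omega)
  have e2 : primeProd (6 * k + 8 + 1) = primeProd (6 * k + 8) :=
    primeProd_succ_of_not_prime fun h =>
      not_prime_of_dvd_of_lt (d := 2) (by omega) (by omega) (by omega) h.1
  have e3 : primeProd (6 * k + 9 + 1) = primeProd (6 * k + 9) :=
    primeProd_succ_of_not_prime fun h =>
      not_prime_of_dvd_of_lt (d := 3) (by omega) (by omega) (by omega) h.1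
  have e4 : primeProd (6 * k + 10 + 1) = primeProd (6 * k + 10) :=
    primeProd_succ_of_not_prime fun h =>
      not_prime_of_dvd_of_lt (d := 2) (by omega) (by omega) (by omega) h.1
  have e5 := primeProd_succ_le (n := 6 * k + 11) (by omega)
  norm_num [add_assoc] at e0 e1 e2 e3 e4 e5
  rw [show 6 * (k + 1) + 6 = 6 * k + 12 by ring]
  have hk : (0 : ℝ) ≤ k := Nat.cast_nonneg k
  rw [e4, e3, e2] at e5
  rw [e0] at e1
  have h5 : (6 * (k : ℝ) + 11 - 2)⁻¹ ≤ 1 / (6 * (k : ℝ) + 5) := by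
    rw [one_div]; exact inv_anti₀ (by linarith) (by linarith)
  have h1 : (6 * (k : ℝ) + 7 - 2)⁻¹ = 1 / (6 * (k : ℝ) + 5) := by
    rw [one_div]; congr 1; ring
  rw [h1] at e1
  have hpos : 0 ≤ 1 / (6 * (k : ℝ) + 5) := by positivity
  have hM := (primeProd_pos (6 * k + 8)).le
  calc primeProd (6 * k + 12) ≤ _ := e5
    _ ≤ (1 + 1 / (6 * (k : ℝ) + 5)) * primeProd (6 * k + 8) := by
        gcongr
    _ ≤ (1 + 1 / (6 * (k : ℝ) + 5)) * ((1 + 1 / (6 * (k : ℝ) + 5)) * primeProd (6 * k + 6)) := by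
        gcongr
    _ = _ := by ring

theorem one_add_inv_pow_five_le {u : ℝ} (hu : 17 ≤ u) : (1 + 1 / u) ^ 5 ≤ 1 + 6 / (u + 1) := by
  obtain ⟨x, rfl⟩ : ∃ x, u = x + 17 := ⟨u - 17, by ring⟩
  have hx : 0 ≤ x := by linarith
  have h1 : (1 + 1 / (x + 17)) = (x + 18) / (x + 17) := by field_simp; ring
  have h2 : 1 + 6 / (x + 17 + 1) = (x + 24) / (x + 18) := by field_simp; ring
  rw [h1, h2, div_pow, div_le_div_iff₀ (by positivity) (by positivity)]
  rw [← sub_nonneg]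
  ring_nf
  positivity

/-- A sieve by `2` and `3` gives a power of `n` with exponent `2/5 < 1/2`, which is all that the
convergence of the Romanov series needs. -/
theorem exists_primeProd_pow_five_le :
    ∃ C : ℝ, 0 < C ∧ ∀ n : ℕ, 1 ≤ n → primeProd n ^ 5 ≤ C * (n : ℝ) ^ 2 := by
  -- The induction starts at `k = 2`, where `6 k + 5 = 17` makes `one_add_inv_pow_five_le` applicable.
  have key : ∀ k : ℕ, 2 ≤ k →
      primeProd (6 * k + 6) ^ 5 ≤ primeProd 18 ^ 5 * ((k : ℝ) + 1) ^ 2 := by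
    intro k hk
    induction k, hk using Nat.le_induction with
    | base =>
      norm_num
      nlinarith [pow_pos (primeProd_pos 18) 5]
    | succ k hk ih =>
      have hk' : (2 : ℝ) ≤ k := by exact_mod_cast hk
      have h1 := one_add_inv_pow_five_le (u := 6 * (k : ℝ) + 5) (by linarith)
      have h2 : 1 + 6 / (6 * (k : ℝ) + 5 + 1) = ((k : ℝ) + 2) / (k + 1) := by
        field_simp; ring
      rw [h2] at h1
      calc primeProd (6 * (k + 1) + 6) ^ 5
          ≤ ((1 + 1 / (6 * (k : ℝ) + 5)) ^ 2 * primeProd (6 * k + 6)) ^ 5 :=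
            pow_le_pow_left₀ (primeProd_pos _).le (primeProd_add_six_le k) 5
        _ = ((1 + 1 / (6 * (k : ℝ) + 5)) ^ 5) ^ 2 * primeProd (6 * k + 6) ^ 5 := by ring
        _ ≤ (((k : ℝ) + 2) / (k + 1)) ^ 2 * (primeProd 18 ^ 5 * ((k : ℝ) + 1) ^ 2) := by
            have := (pow_pos (primeProd_pos (6 * k + 6)) 5).le
            gcongr
        _ = primeProd 18 ^ 5 * (((k + 1 : ℕ) : ℝ) + 1) ^ 2 := by
            push_cast
            field_simp
            ring
  refine ⟨16 * primeProd 18 ^ 5, by have := primeProd_pos 18; positivity, fun n hn => ?_⟩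
  have hn' : (1 : ℝ) ≤ n := by exact_mod_cast hn
  have h6 : ((n / 6 : ℕ) : ℝ) ≤ n := by exact_mod_cast Nat.div_le_self n 6
  have h60 : (0 : ℝ) ≤ ((n / 6 : ℕ) : ℝ) := Nat.cast_nonneg _
  calc primeProd n ^ 5 ≤ primeProd (6 * (n / 6 + 2) + 6) ^ 5 :=
        pow_le_pow_left₀ (primeProd_pos _).le (primeProd_mono (by omega)) 5
    _ ≤ primeProd 18 ^ 5 * (((n / 6 + 2 : ℕ) : ℝ) + 1) ^ 2 := key _ (by omega)
    _ ≤ primeProd 18 ^ 5 * (4 * (n : ℝ)) ^ 2 := by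
        have := (pow_pos (primeProd_pos 18) 5).le
        gcongr
        push_cast
        linarith
    _ = _ := by ring

theorem exists_primeProd_le_rpow :
    ∃ C : ℝ, 0 < C ∧ ∀ n : ℕ, 1 ≤ n → primeProd n ≤ C * (n : ℝ) ^ (2 / 5 : ℝ) := by
  obtain ⟨C, hC, h⟩ := exists_primeProd_pow_five_le
  refine ⟨C ^ (1 / 5 : ℝ), by positivity, fun n hn => ?_⟩
  have hn0 : (0 : ℝ) ≤ n := Nat.cast_nonneg n
  refine le_of_pow_le_pow_left₀ (n := 5) (by norm_num) (by positivity) ((h n hn).trans_eq ?_)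
  rw [mul_pow, ← Real.rpow_natCast (C ^ (1 / 5 : ℝ)), ← Real.rpow_mul hC.le,
    ← Real.rpow_natCast ((n : ℝ) ^ (2 / 5 : ℝ)), ← Real.rpow_mul hn0]
  norm_num

/-! ### The order of `2` modulo odd primes -/

theorem isUnit_two_zmod {n : ℕ} (hn : Odd n) : IsUnit (2 : ZMod n) := by
  have : IsUnit ((2 : ℕ) : ZMod n) :=
    (ZMod.isUnit_iff_coprime 2 n).2 (Nat.coprime_two_left.2 hn)
  simpa using this

theorem orderOf_two_pos {n : ℕ} (hn : Odd n) : 0 < orderOf (2 : ZMod n) := by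
  obtain ⟨u, hu⟩ := isUnit_two_zmod hn
  have : NeZero n := ⟨hn.pos.ne'⟩
  rw [← hu, orderOf_units]
  exact orderOf_pos u

theorem odd_of_prime_of_two_lt {p : ℕ} (hp : p.Prime ∧ 2 < p) : Odd p :=
  hp.1.odd_of_ne_two hp.2.ne'

theorem orderOf_two_dvd_sub_one {p : ℕ} (hp : p.Prime ∧ 2 < p) :
    orderOf (2 : ZMod p) ∣ p - 1 := by
  have : Fact p.Prime := ⟨hp.1⟩
  exact orderOf_dvd_of_pow_eq_one
    (ZMod.pow_card_sub_one_eq_one (isUnit_two_zmod (odd_of_prime_of_two_lt hp)).ne_zero)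

theorem orderOf_two_le {p : ℕ} (hp : p.Prime ∧ 2 < p) : orderOf (2 : ZMod p) ≤ p :=
  (Nat.le_of_dvd (by omega) (orderOf_two_dvd_sub_one hp)).trans (Nat.sub_le p 1)

/-- At most `t` primes have order exactly `t`, since all of them divide `2 ^ t - 1`. -/
theorem card_orderOf_two_eq_le (S : Finset ℕ) (hS : ∀ p ∈ S, p.Prime ∧ 2 < p) (t : ℕ) :
    ({p ∈ S | orderOf (2 : ZMod p) = t} : Finset ℕ).card ≤ t := by
  rcases Nat.eq_zero_or_pos t with rfl | ht
  · refine (Finset.card_eq_zero.2 (Finset.filter_eq_empty_iff.2 fun p hp h => ?_)).le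
    exact (orderOf_two_pos (odd_of_prime_of_two_lt (hS p hp))).ne' h
  have h2t : 2 ≤ 2 ^ t := by simpa using Nat.pow_le_pow_right (n := 2) (by norm_num) ht
  have hne : 2 ^ t - 1 ≠ 0 := by omega
  have hsub : ({p ∈ S | orderOf (2 : ZMod p) = t} : Finset ℕ) ⊆ (2 ^ t - 1).primeFactors := by
    intro p hp
    rw [Finset.mem_filter] at hp
    refine Nat.mem_primeFactors.2 ⟨(hS p hp.1).1, ?_, hne⟩
    rw [← CharP.cast_eq_zero_iff (ZMod p) p, Nat.cast_sub (by omega)]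
    push_cast
    rw [← hp.2, pow_orderOf_eq_one, sub_self]
  refine (Finset.card_le_card hsub).trans ?_
  have h1 : 2 ^ (2 ^ t - 1).primeFactors.card ≤ ∏ p ∈ (2 ^ t - 1).primeFactors, p :=
    Finset.pow_card_le_prod _ _ _ fun p hp => (Nat.prime_of_mem_primeFactors hp).two_le
  have h2 : ∏ p ∈ (2 ^ t - 1).primeFactors, p ≤ 2 ^ t - 1 :=
    Nat.le_of_dvd (by omega) (Nat.prod_primeFactors_dvd _)
  exact (Nat.pow_le_pow_iff_right (a := 2) (by norm_num)).1 (h1.trans (h2.trans (Nat.sub_le _ _)))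

/-! ### Convergence of the Romanov series -/

/-- For an odd prime `p`, the total weight `g(p) ∏_{2 < q < p} (1 + g(q)) / ord_p(2)` of the
squarefree odd numbers with largest prime factor `p`, after `ord_β(2)` has been
replaced by `ord_p(2)`; and `0` at every other `p`. -/
noncomputable def romanovWeight (p : ℕ) : ℝ :=
  if p.Prime ∧ 2 < p then 1 / ((p : ℝ) - 2) * primeProd p / (orderOf (2 : ZMod p) : ℝ) else 0

theorem romanovWeight_nonneg (p : ℕ) : 0 ≤ romanovWeight p := by
  rw [romanovWeight]
  split_ifs with h
  · have := one_div_sub_two_pos h.2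
    have := primeProd_pos p
    positivity
  · exact le_rfl

theorem summable_orderOf_two_rpow :
    Summable fun p : ℕ =>
      if p.Prime ∧ 2 < p then (orderOf (2 : ZMod p) : ℝ) ^ (-(11 / 5) : ℝ) else 0 := by
  have hs : Summable fun t : ℕ => (t : ℝ) ^ (-(6 / 5) : ℝ) :=
    Real.summable_nat_rpow.2 (by norm_num)
  refine summable_of_sum_le (c := ∑' t : ℕ, (t : ℝ) ^ (-(6 / 5) : ℝ))
    (fun p => by dsimp only; split_ifs <;> positivity) fun u => ?_
  rw [← Finset.sum_filter]
  set S := ({p ∈ u | p.Prime ∧ 2 < p} : Finset ℕ)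
  have hS : ∀ p ∈ S, p.Prime ∧ 2 < p := fun p hp => (Finset.mem_filter.1 hp).2
  rw [Finset.sum_comp (fun t : ℕ => (t : ℝ) ^ (-(11 / 5) : ℝ)) (fun p => orderOf (2 : ZMod p))]
  refine le_trans (Finset.sum_le_sum (g := fun t : ℕ => (t : ℝ) ^ (-(6 / 5) : ℝ)) fun t ht => ?_)
    (hs.sum_le_tsum _ fun t _ => by positivity)
  obtain ⟨p, hp, rfl⟩ := Finset.mem_image.1 ht
  have htpos : (0 : ℝ) < (orderOf (2 : ZMod p) : ℝ) := by
    exact_mod_cast orderOf_two_pos (odd_of_prime_of_two_lt (hS p hp))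
  rw [nsmul_eq_mul]
  refine le_trans (mul_le_mul_of_nonneg_right
    (Nat.cast_le.2 (card_orderOf_two_eq_le S hS _)) (by positivity)) (le_of_eq ?_)
  rw [← Real.rpow_one_add' htpos.le (by norm_num)]
  norm_num

/-- Convergence is clear for primes with `ord_p(2) ≥ √p`, by comparison with `p ^ (-11/10)`; the
other primes are counted by the value of `ord_p(2)`. -/
theorem summable_romanovWeight : Summable romanovWeight := by
  obtain ⟨C, hC, hM⟩ := exists_primeProd_le_rpow
  have hs1 : Summable fun p : ℕ => (p : ℝ) ^ (-(11 / 10) : ℝ) :=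
    Real.summable_nat_rpow.2 (by norm_num)
  refine Summable.of_nonneg_of_le romanovWeight_nonneg (fun p => ?_)
    ((hs1.add summable_orderOf_two_rpow).mul_left (3 * C))
  rw [romanovWeight]
  split_ifs with h
  swap
  · positivity
  have hp3 : (3 : ℝ) ≤ p := by exact_mod_cast h.2
  have hp0 : (0 : ℝ) < p := by linarith
  set t : ℝ := (orderOf (2 : ZMod p) : ℝ)
  have ht : 0 < t := Nat.cast_pos.2 (orderOf_two_pos (odd_of_prime_of_two_lt h))
  have hg : 1 / ((p : ℝ) - 2) ≤ 3 * (p : ℝ)⁻¹ := by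
    rw [← div_eq_mul_inv, div_le_div_iff₀ (by linarith) hp0]
    linarith
  have h1 : 1 / ((p : ℝ) - 2) * primeProd p / t ≤ 3 * C * ((p : ℝ) ^ (-(3 / 5) : ℝ) / t) := by
    have h0 := (primeProd_pos p).le
    calc 1 / ((p : ℝ) - 2) * primeProd p / t
        ≤ (3 * (p : ℝ)⁻¹) * (C * (p : ℝ) ^ (2 / 5 : ℝ)) / t := by
          gcongr
          exact hM p (by omega)
      _ = 3 * C * (((p : ℝ) ^ (-1 : ℝ) * (p : ℝ) ^ (2 / 5 : ℝ)) / t) := by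
          rw [Real.rpow_neg_one]; ring
      _ = _ := by
          rw [← Real.rpow_add hp0]; norm_num
  refine h1.trans (mul_le_mul_of_nonneg_left ?_ (by positivity))
  rcases le_total ((p : ℝ) ^ (1 / 2 : ℝ)) t with hpt | hpt
  · refine le_trans ?_ (le_add_of_nonneg_right (by positivity))
    calc (p : ℝ) ^ (-(3 / 5) : ℝ) / t ≤ (p : ℝ) ^ (-(3 / 5) : ℝ) / (p : ℝ) ^ (1 / 2 : ℝ) := by
          gcongr
      _ = _ := by rw [← Real.rpow_sub hp0]; norm_num
  · refine le_trans ?_ (le_add_of_nonneg_left (by positivity))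
    have h2 : t ^ (6 / 5 : ℝ) ≤ (p : ℝ) ^ (3 / 5 : ℝ) := by
      refine (Real.rpow_le_rpow ht.le hpt (by norm_num)).trans_eq ?_
      rw [← Real.rpow_mul hp0.le]; norm_num
    calc (p : ℝ) ^ (-(3 / 5) : ℝ) / t ≤ t ^ (-(6 / 5) : ℝ) / t := by
          rw [Real.rpow_neg hp0.le, Real.rpow_neg ht.le]
          gcongr
      _ = _ := by rw [← Real.rpow_sub_one ht.ne']; norm_num

theorem orderOf_two_dvd_of_dvd {m n : ℕ} (h : m ∣ n) :
    orderOf (2 : ZMod m) ∣ orderOf (2 : ZMod n) := by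
  have h2 : (ZMod.castHom h (ZMod m)) 2 = 2 := map_ofNat _ 2
  rw [← h2]
  exact orderOf_map_dvd (ZMod.castHom h (ZMod m) : ZMod n →* ZMod m) 2

/-- The Romanov terms of the squarefree numbers with a given set of prime factors below `n`,
grouped by their largest prime factor. -/
theorem sum_powerset_oddPrimesBelow_le (n : ℕ) :
    ∑ s ∈ (oddPrimesBelow n).powerset,
        (∏ p ∈ s, 1 / ((p : ℝ) - 2)) / (orderOf (2 : ZMod (∏ p ∈ s, p)) : ℝ) ≤
      1 + ∑ p ∈ Finset.range n, romanovWeight p := by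
  induction n with
  | zero =>
    simp only [oddPrimesBelow, Finset.range_zero, Finset.filter_empty, Finset.powerset_empty,
      Finset.sum_singleton, Finset.prod_empty, Finset.sum_empty, add_zero, one_div]
    exact Nat.cast_inv_le_one _
  | succ n ih =>
    by_cases hn : n.Prime ∧ 2 < n
    swap
    · rw [oddPrimesBelow_succ_of_not_prime hn, Finset.sum_range_succ, romanovWeight, if_neg hn,
        add_zero]
      exact ih
    rw [oddPrimesBelow_succ_of_prime hn,
      Finset.sum_powerset_insert (self_notMem_oddPrimesBelow n), Finset.sum_range_succ,
      ← add_assoc]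
    refine add_le_add ih ?_
    rw [romanovWeight, if_pos hn, primeProd, Finset.prod_one_add, Finset.mul_sum, Finset.sum_div]
    refine Finset.sum_le_sum fun s hs => ?_
    rw [Finset.mem_powerset] at hs
    have hns : n ∉ s := fun h => self_notMem_oddPrimesBelow n (hs h)
    rw [Finset.prod_insert hns]
    have hs' : ∀ p ∈ insert n s, p.Prime ∧ 2 < p := by
      intro p hp
      rcases Finset.mem_insert.1 hp with rfl | hp
      · exact hn
      · exact (mem_oddPrimesBelow.1 (hs hp)).2
    have hodd : Odd (∏ p ∈ insert n s, p) :=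
      Finset.prod_induction _ Odd (fun _ _ => Odd.mul) odd_one
        fun p hp => odd_of_prime_of_two_lt (hs' p hp)
    have hg : 0 ≤ ∏ p ∈ s, 1 / ((p : ℝ) - 2) := Finset.prod_nonneg fun p hp =>
      (one_div_sub_two_pos (hs' p (Finset.mem_insert_of_mem hp)).2).le
    have hgn := one_div_sub_two_pos hn.2
    have hord : (orderOf (2 : ZMod n) : ℝ) ≤ (orderOf (2 : ZMod (∏ p ∈ insert n s, p)) : ℝ) :=
      Nat.cast_le.2 (Nat.le_of_dvd (orderOf_two_pos hodd)
        (orderOf_two_dvd_of_dvd (Finset.dvd_prod_of_mem _ (Finset.mem_insert_self n s))))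
    have hpos : (0 : ℝ) < (orderOf (2 : ZMod n) : ℝ) :=
      Nat.cast_pos.2 (orderOf_two_pos (odd_of_prime_of_two_lt hn))
    gcongr

theorem romanovTerm_eq {β : ℕ} (h : Odd β ∧ Squarefree β) :
    romanovTerm β = (∏ p ∈ β.primeFactors, 1 / ((p : ℝ) - 2)) /
      (orderOf (2 : ZMod (∏ p ∈ β.primeFactors, p)) : ℝ) := by
  have hμ : (ArithmeticFunction.moebius β : ℝ) ^ 2 = 1 := by
    exact_mod_cast ArithmeticFunction.moebius_sq_eq_one_of_squarefree h.2
  rw [romanovTerm, if_pos h.1, gFun, if_pos h, hμ, one_mul,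
    Nat.prod_primeFactors_of_squarefree h.2]

theorem romanovTerm_eq_zero {β : ℕ} (h : ¬ (Odd β ∧ Squarefree β)) : romanovTerm β = 0 := by
  rw [romanovTerm, gFun, if_neg h]
  simp

theorem prime_two_lt_of_mem_primeFactors {β p : ℕ} (hβ : Odd β) (hp : p ∈ β.primeFactors) :
    p.Prime ∧ 2 < p := by
  have h := Nat.prime_of_mem_primeFactors hp
  refine ⟨h, lt_of_le_of_ne h.two_le fun h2 => ?_⟩
  exact Nat.not_even_iff_odd.2 hβ (even_iff_two_dvd.2 (h2 ▸ Nat.dvd_of_mem_primeFactors hp))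

theorem romanovTerm_nonneg (β : ℕ) : 0 ≤ romanovTerm β := by
  by_cases h : Odd β ∧ Squarefree β
  · rw [romanovTerm_eq h]
    exact div_nonneg (Finset.prod_nonneg fun p hp =>
      (one_div_sub_two_pos (prime_two_lt_of_mem_primeFactors h.1 hp).2).le) (Nat.cast_nonneg _)
  · exact (romanovTerm_eq_zero h).ge

theorem sum_range_romanovTerm_le (n : ℕ) :
    ∑ β ∈ Finset.range n, romanovTerm β ≤ 1 + ∑ p ∈ Finset.range n, romanovWeight p := by
  classical
  refine le_trans ?_ (sum_powerset_oddPrimesBelow_le n)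
  rw [← Finset.sum_filter_of_ne (p := fun β : ℕ => Odd β ∧ Squarefree β)
    (fun β _ hβ => by_contra fun h => hβ (romanovTerm_eq_zero h))]
  set S := ({β ∈ Finset.range n | Odd β ∧ Squarefree β} : Finset ℕ)
  have hinj : Set.InjOn Nat.primeFactors (S : Set ℕ) := by
    intro a ha b hb hab
    have ha := (Finset.mem_filter.1 ha).2.2
    have hb := (Finset.mem_filter.1 hb).2.2
    rw [← Nat.prod_primeFactors_of_squarefree ha, hab, Nat.prod_primeFactors_of_squarefree hb]
  rw [Finset.sum_congr rfl fun β hβ => romanovTerm_eq (Finset.mem_filter.1 hβ).2,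
    ← Finset.sum_image (g := Nat.primeFactors) (f := fun s : Finset ℕ =>
      (∏ p ∈ s, 1 / ((p : ℝ) - 2)) / (orderOf (2 : ZMod (∏ p ∈ s, p)) : ℝ)) hinj]
  refine Finset.sum_le_sum_of_subset_of_nonneg (fun s hs => ?_) fun s hs _ => ?_
  · obtain ⟨β, hβ, rfl⟩ := Finset.mem_image.1 hs
    obtain ⟨hβn, hβ⟩ := Finset.mem_filter.1 hβ
    refine Finset.mem_powerset.2 fun p hp => mem_oddPrimesBelow.2
      ⟨?_, prime_two_lt_of_mem_primeFactors hβ.1 hp⟩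
    exact (Nat.le_of_mem_primeFactors hp).trans_lt (Finset.mem_range.1 hβn)
  · exact div_nonneg (Finset.prod_nonneg fun p hp => (one_div_sub_two_pos
      (mem_oddPrimesBelow.1 (Finset.mem_powerset.1 hs hp)).2.2).le) (Nat.cast_nonneg _)

theorem summable_romanovTerm : Summable romanovTerm :=
  summable_of_sum_range_le romanovTerm_nonneg fun n =>
    (sum_range_romanovTerm_le n).trans (add_le_add_right
      (summable_romanovWeight.sum_le_tsum _ fun p _ => romanovWeight_nonneg p) 1)

/-- The term `β = 1` of the series is `1`. -/
theorem one_le_romanovConst : 1 ≤ romanovConst := by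
  have h := summable_romanovTerm.le_tsum 1 fun β _ => romanovTerm_nonneg β
  have h1 : romanovTerm 1 = 1 := by
    have : orderOf (2 : ZMod 1) = 1 := orderOf_eq_one_iff.2 (Subsingleton.elim _ _)
    rw [romanovTerm_eq ⟨odd_one, squarefree_one⟩, Nat.primeFactors_one, Finset.prod_empty,
      Finset.prod_empty, this, Nat.cast_one, div_one]
  rwa [h1] at h

/-! ### The contribution of the primes below a bound -/

/-- The part `∏_{2 < p < z, p ∣ d} (1 + 1/(p-2))` of the product over the prime factors of `d` that
comes from the primes below `z`. -/
noncomputable def smoothProd (z : ℕ) (d : ℤ) : ℝ :=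
  ∏ p ∈ oddPrimesBelow z with ((p : ℕ) : ℤ) ∣ d, (1 + 1 / ((p : ℝ) - 2))

theorem smoothProd_succ_of_prime {n : ℕ} (hn : n.Prime ∧ 2 < n) (d : ℤ) :
    smoothProd (n + 1) d =
      smoothProd n d + if (n : ℤ) ∣ d then 1 / ((n : ℝ) - 2) * smoothProd n d else 0 := by
  rw [smoothProd, oddPrimesBelow_succ_of_prime hn, Finset.filter_insert]
  split_ifs with h
  · rw [Finset.prod_insert (fun h' => self_notMem_oddPrimesBelow n (Finset.mem_filter.1 h').1),
      smoothProd]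
    ring
  · rw [smoothProd, add_zero]

theorem smoothProd_succ_of_not_prime {n : ℕ} (hn : ¬ (n.Prime ∧ 2 < n)) (d : ℤ) :
    smoothProd (n + 1) d = smoothProd n d := by
  rw [smoothProd, oddPrimesBelow_succ_of_not_prime hn, smoothProd]

theorem one_le_smoothProd (z : ℕ) (d : ℤ) : 1 ≤ smoothProd z d := by
  refine Finset.one_le_prod (fun p hp => ?_)
  have := one_div_sub_two_pos (mem_oddPrimesBelow.1 (Finset.mem_filter.1 hp).1).2.2
  linarith

theorem smoothProd_nonneg (z : ℕ) (d : ℤ) : 0 ≤ smoothProd z d :=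
  zero_le_one.trans (one_le_smoothProd z d)

theorem smoothProd_le_primeProd (z : ℕ) (d : ℤ) : smoothProd z d ≤ primeProd z := by
  induction z with
  | zero => simp [smoothProd, primeProd, oddPrimesBelow]
  | succ n ih =>
    by_cases hn : n.Prime ∧ 2 < n
    · rw [smoothProd_succ_of_prime hn, primeProd_succ_of_prime hn]
      have := one_div_sub_two_pos hn.2
      split_ifs <;> nlinarith [primeProd_pos n]
    · rwa [smoothProd_succ_of_not_prime hn, primeProd_succ_of_not_prime hn]

/-- Expanding the product one prime at a time: the primes in `[y, z)` dividing `d` enter through a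
sum over the largest prime used, with the smaller primes bounded trivially. -/
theorem smoothProd_le_add_sum {y z : ℕ} (hyz : y ≤ z) (d : ℤ) :
    smoothProd z d ≤ smoothProd y d + ∑ p ∈ Finset.Ico y z,
      if (p.Prime ∧ 2 < p) ∧ (p : ℤ) ∣ d then 1 / ((p : ℝ) - 2) * primeProd p else 0 := by
  induction z, hyz using Nat.le_induction with
  | base => simp
  | succ n hyn ih =>
    rw [Finset.sum_Ico_succ_top hyn]
    by_cases hn : n.Prime ∧ 2 < n
    · rw [smoothProd_succ_of_prime hn]
      have hg := one_div_sub_two_pos hn.2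
      have := mul_le_mul_of_nonneg_left (smoothProd_le_primeProd n d) hg.le
      by_cases hd : (n : ℤ) ∣ d
      · rw [if_pos hd, if_pos ⟨hn, hd⟩]
        linarith
      · rw [if_neg hd, if_neg (fun h => hd h.2)]
        linarith
    · rw [smoothProd_succ_of_not_prime hn, if_neg (fun h => hn h.1)]
      linarith

theorem intCast_diffD (k h n : ℕ) :
    ((diffD k h : ℤ) : ZMod n) = 2 ^ k * (2 ^ h - 1) - (h : ZMod n) := by
  simp [diffD]

theorem dvd_diffD_iff (k h n : ℕ) :
    (n : ℤ) ∣ diffD k h ↔ (2 : ZMod n) ^ k * (2 ^ h - 1) = (h : ZMod n) := by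
  rw [← ZMod.intCast_zmod_eq_zero_iff_dvd, intCast_diffD, sub_eq_zero]

/-! ### How often a prime divides `diffD k h` -/

theorem card_modEq_class_le {t K : ℕ} (s : Finset ℕ) (hs : ∀ k ∈ s, k ≤ K)
    (h : ∀ k ∈ s, ∀ l ∈ s, k ≡ l [MOD t]) : s.card ≤ K / t + 1 := by
  rw [← Finset.card_range (K / t + 1)]
  refine Finset.card_le_card_of_injOn (fun k => k / t) (fun k hk => ?_) fun k hk l hl hkl => ?_
  · exact Finset.mem_coe.2 (Finset.mem_range.2 (Nat.lt_succ_of_le (Nat.div_le_div_right (hs k hk))))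
  · have h1 : k % t = l % t := h k hk l hl
    have h2 : k / t = l / t := hkl
    rw [← Nat.div_add_mod k t, ← Nat.div_add_mod l t, h1, h2]

/-- If `p ∤ h`, the solutions `k` of `2 ^ k (2 ^ h - 1) ≡ h` modulo `p` form at most one residue
class modulo `ord_p(2)`. -/
theorem card_dvd_diffD_le {p h K : ℕ} (hp : p.Prime ∧ 2 < p) (hph : ¬ p ∣ h) :
    ({k ∈ Finset.Icc 1 K | (p : ℤ) ∣ diffD k h} : Finset ℕ).card ≤
      K / orderOf (2 : ZMod p) + 1 := by
  have : Fact p.Prime := ⟨hp.1⟩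
  refine card_modEq_class_le _ (fun k hk => (Finset.mem_Icc.1 (Finset.mem_filter.1 hk).1).2)
    fun k hk l hl => ?_
  have hk := (dvd_diffD_iff _ _ _).1 (Finset.mem_filter.1 hk).2
  have hl := (dvd_diffD_iff _ _ _).1 (Finset.mem_filter.1 hl).2
  have h0 : (h : ZMod p) ≠ 0 := fun h0 => hph ((CharP.cast_eq_zero_iff (ZMod p) p h).1 h0)
  have hc : ((2 : ZMod p) ^ h - 1) ≠ 0 := fun hc => h0 (by rw [← hk, hc, mul_zero])
  have hfin : IsOfFinOrder (2 : ZMod p) :=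
    orderOf_pos_iff.1 (orderOf_two_pos (odd_of_prime_of_two_lt hp))
  exact hfin.pow_eq_pow_iff_modEq.1 (mul_right_cancel₀ hc (hk.trans hl.symm))

theorem sum_card_dvd_diffD_le {p K : ℕ} (hp : p.Prime ∧ 2 < p) (hpK : p ≤ K) :
    (∑ h ∈ Finset.Icc 1 K,
      (({k ∈ Finset.Icc 1 K | (p : ℤ) ∣ diffD k h} : Finset ℕ).card : ℝ)) ≤
      3 * (K : ℝ) ^ 2 / (orderOf (2 : ZMod p) : ℝ) := by
  set t := orderOf (2 : ZMod p)
  have ht : 0 < t := orderOf_two_pos (odd_of_prime_of_two_lt hp)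
  have htp : t ≤ p := orderOf_two_le hp
  have ht' : (0 : ℝ) < t := Nat.cast_pos.2 ht
  have hK : (1 : ℝ) ≤ (K : ℝ) / t := by
    rw [one_le_div ht']
    exact_mod_cast htp.trans hpK
  have hterm : ∀ h ∈ Finset.Icc 1 K,
      (({k ∈ Finset.Icc 1 K | (p : ℤ) ∣ diffD k h} : Finset ℕ).card : ℝ) ≤
        (if p ∣ h then (K : ℝ) else 0) + 2 * (K : ℝ) / t := by
    intro h _
    split_ifs with hph
    · have h1 : ({k ∈ Finset.Icc 1 K | (p : ℤ) ∣ diffD k h} : Finset ℕ).card ≤ K := by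
        simpa using Finset.card_filter_le (Finset.Icc 1 K) (fun k => (p : ℤ) ∣ diffD k h)
      have h2 : (({k ∈ Finset.Icc 1 K | (p : ℤ) ∣ diffD k h} : Finset ℕ).card : ℝ) ≤ K := by
        exact_mod_cast h1
      have : 0 ≤ 2 * (K : ℝ) / t := by positivity
      linarith
    · have h1 : (({k ∈ Finset.Icc 1 K | (p : ℤ) ∣ diffD k h} : Finset ℕ).card : ℝ) ≤
          ((K / t : ℕ) : ℝ) + 1 := by exact_mod_cast card_dvd_diffD_le hp hph
      have h2 : ((K / t : ℕ) : ℝ) ≤ (K : ℝ) / t := Nat.cast_div_le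
      rw [mul_div_assoc]
      linarith
  refine (Finset.sum_le_sum hterm).trans ?_
  rw [Finset.sum_add_distrib, ← Finset.sum_filter, Finset.sum_const, Finset.sum_const,
    show Finset.Icc 1 K = Finset.Ioc 0 K from rfl, Nat.Ioc_filter_dvd_card_eq_div, Nat.card_Ioc,
    nsmul_eq_mul, nsmul_eq_mul, tsub_zero]
  have h3 : ((K / p : ℕ) : ℝ) ≤ (K : ℝ) / t :=
    Nat.cast_div_le.trans (div_le_div_of_nonneg_left (Nat.cast_nonneg K) ht' (Nat.cast_le.2 htp))
  calc ((K / p : ℕ) : ℝ) * (K : ℝ) + K * (2 * (K : ℝ) / t)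
      ≤ (K : ℝ) / t * K + K * (2 * (K : ℝ) / t) := by gcongr
    _ = _ := by ring

/-! ### Mean values along arithmetic progressions -/

theorem abs_sum_shift_sub_le {u : ℕ → ℝ} {B : ℝ} (h0 : ∀ m, 0 ≤ u m) (hB : ∀ m, u m ≤ B)
    (X s : ℕ) :
    |∑ m ∈ Finset.range X, u (m + s) - ∑ m ∈ Finset.range X, u m| ≤ s * B := by
  have h1 := Finset.sum_range_add u X s
  have h2 := Finset.sum_range_add u s X
  rw [add_comm s X] at h2
  simp only [add_comm s] at h2
  have hb : ∀ a : ℕ → ℕ, 0 ≤ ∑ i ∈ Finset.range s, u (a i) ∧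
      ∑ i ∈ Finset.range s, u (a i) ≤ s * B := fun a =>
    ⟨Finset.sum_nonneg fun i _ => h0 _,
      (Finset.sum_le_card_nsmul _ _ B fun i _ => hB _).trans_eq (by simp)⟩
  have h3 := hb fun i => X + i
  have h4 := hb fun i => i
  rw [abs_le]
  constructor <;> linarith [h3.1, h3.2, h4.1, h4.2]

theorem dvd_diffD_add_iff {q Q : ℕ} (hq : q.Prime ∧ 2 < q) (hqQ : q ∣ Q) (hq1 : q - 1 ∣ Q)
    (k m j : ℕ) : (q : ℤ) ∣ diffD k (2 * (m + Q * j)) ↔ (q : ℤ) ∣ diffD k (2 * m) := by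
  have h1 : (2 : ZMod q) ^ (2 * (m + Q * j)) = 2 ^ (2 * m) := by
    rw [mul_add, pow_add, show 2 * (Q * j) = Q * (2 * j) by ring, pow_mul _ Q,
      orderOf_dvd_iff_pow_eq_one.1 ((orderOf_two_dvd_sub_one hq).trans hq1), one_pow, mul_one]
  have h2 : (Q : ZMod q) = 0 := (CharP.cast_eq_zero_iff (ZMod q) q Q).2 hqQ
  rw [dvd_diffD_iff, dvd_diffD_iff, h1]
  push_cast
  rw [h2, zero_mul, add_zero]

theorem smoothProd_diffD_add (n k m j : ℕ) :
    smoothProd n (diffD k (2 * (m + (n - 1).factorial * j))) = smoothProd n (diffD k (2 * m)) := by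
  rw [smoothProd, smoothProd]
  congr 1
  refine Finset.filter_congr fun q hq => ?_
  obtain ⟨hqn, hq⟩ := mem_oddPrimesBelow.1 hq
  exact dvd_diffD_add_iff hq (Nat.dvd_factorial hq.1.pos (by omega))
    (Nat.dvd_factorial (by omega) (by omega)) k m j

/-- Shifting `m` by multiples of `(n-1)!` does not change `2 ^ (2 m)` modulo `n`, while `2 m` runs
through every residue class once. -/
theorem sum_ite_dvd_diffD_add {n : ℕ} (hn : n.Prime ∧ 2 < n) (k m : ℕ) (c : ℝ) :
    (∑ j ∈ Finset.range n,
      if (n : ℤ) ∣ diffD k (2 * (m + (n - 1).factorial * j)) then c else 0) = c := by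
  have : Fact n.Prime := ⟨hn.1⟩
  set Q := (n - 1).factorial
  have h2 : (2 : ZMod n) ≠ 0 := (isUnit_two_zmod (odd_of_prime_of_two_lt hn)).ne_zero
  have hQ : (Q : ZMod n) ≠ 0 := fun h =>
    absurd ((hn.1.dvd_factorial).1 ((CharP.cast_eq_zero_iff (ZMod n) n Q).1 h)) (by omega)
  have hpow : ∀ j : ℕ, (2 : ZMod n) ^ (2 * (m + Q * j)) = 2 ^ (2 * m) := fun j => by
    have hd : n - 1 ∣ Q := Nat.dvd_factorial (by omega) le_rfl
    rw [mul_add, pow_add, show 2 * (Q * j) = Q * (2 * j) by ring, pow_mul _ Q,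
      orderOf_dvd_iff_pow_eq_one.1 ((orderOf_two_dvd_sub_one hn).trans hd), one_pow, mul_one]
  set x : ZMod n := (2 ^ k * (2 ^ (2 * m) - 1) - 2 * (m : ZMod n)) / (2 * Q)
  have hiff : ∀ j : ℕ, (n : ℤ) ∣ diffD k (2 * (m + Q * j)) ↔ (j : ZMod n) = x := fun j => by
    rw [dvd_diffD_iff, hpow, eq_div_iff (mul_ne_zero h2 hQ)]
    push_cast
    constructor
    · intro h
      rw [h]
      ring
    · intro h
      linear_combination -h
  simp only [hiff]
  rw [Finset.sum_eq_single x.val]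
  · rw [if_pos (ZMod.natCast_zmod_val x)]
  · intro j hj hjx
    refine if_neg fun h => hjx ?_
    rw [← h, ZMod.val_cast_of_lt (Finset.mem_range.1 hj)]
  · intro h
    exact absurd (Finset.mem_range.2 (ZMod.val_lt x)) h

theorem abs_mul_sum_ite_dvd_sub_le {n : ℕ} (hn : n.Prime ∧ 2 < n) (k X : ℕ) :
    |(n : ℝ) * ∑ m ∈ Finset.range X,
        (if (n : ℤ) ∣ diffD k (2 * m) then smoothProd n (diffD k (2 * m)) else 0) -
      ∑ m ∈ Finset.range X, smoothProd n (diffD k (2 * m))| ≤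
      n * (((n - 1).factorial * n : ℕ) * primeProd n) := by
  set Q := (n - 1).factorial
  set u : ℕ → ℝ := fun m =>
    if (n : ℤ) ∣ diffD k (2 * m) then smoothProd n (diffD k (2 * m)) else 0
  have hu0 : ∀ m, 0 ≤ u m := fun m => by
    dsimp only [u]; split_ifs
    exacts [smoothProd_nonneg _ _, le_rfl]
  have huB : ∀ m, u m ≤ primeProd n := fun m => by
    dsimp only [u]; split_ifs
    exacts [smoothProd_le_primeProd _ _, (primeProd_pos n).le]
  have hf : ∀ m, smoothProd n (diffD k (2 * m)) = ∑ j ∈ Finset.range n, u (m + Q * j) := by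
    intro m
    refine (sum_ite_dvd_diffD_add hn k m _).symm.trans (Finset.sum_congr rfl fun j _ => ?_)
    simp only [u, Q, smoothProd_diffD_add]
  have hn' : (n : ℝ) * ∑ m ∈ Finset.range X, u m =
      ∑ _j ∈ Finset.range n, ∑ m ∈ Finset.range X, u m := by simp
  rw [Finset.sum_congr rfl fun m _ => hf m, Finset.sum_comm, hn', ← Finset.sum_sub_distrib]
  refine (Finset.abs_sum_le_sum_abs _ _).trans
    ((Finset.sum_le_card_nsmul _ _ _ fun j hj => ?_).trans_eq
      (by rw [Finset.card_range, nsmul_eq_mul]))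
  rw [abs_sub_comm]
  refine (abs_sum_shift_sub_le hu0 huB X (Q * j)).trans ?_
  have := (primeProd_pos n).le
  have := Nat.mul_le_mul_left Q (Finset.mem_range.1 hj).le
  gcongr

/-- The mean value `∏_{2 < p < z} (1 + g(p)/p)` of `smoothProd z` on the integers. -/
noncomputable def meanProd (z : ℕ) : ℝ :=
  ∏ p ∈ oddPrimesBelow z, (1 + 1 / ((p : ℝ) - 2) / p)

/-- For fixed `k`, the values of `smoothProd z` at `diffD k (2 m)` have the same mean over `m` as
over all integers. The primes are added in increasing order: the period in `m` of the contribution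
of the smaller primes divides `(n-1)!` and so is coprime to the new prime `n`. -/
theorem exists_abs_sum_smoothProd_sub_le (z : ℕ) : ∃ C : ℝ, 0 ≤ C ∧ ∀ k X : ℕ,
    |∑ m ∈ Finset.range X, smoothProd z (diffD k (2 * m)) - X * meanProd z| ≤ C := by
  induction z with
  | zero => exact ⟨0, le_rfl, fun k X => by simp [smoothProd, meanProd, oddPrimesBelow]⟩
  | succ n ih =>
    obtain ⟨C, hC, h⟩ := ih
    by_cases hn : n.Prime ∧ 2 < n
    swap
    · refine ⟨C, hC, fun k X => ?_⟩
      simp only [smoothProd_succ_of_not_prime hn, meanProd, oddPrimesBelow_succ_of_not_prime hn]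
      exact h k X
    have hg := one_div_sub_two_pos hn.2
    have hn0 : (0 : ℝ) < n := Nat.cast_pos.2 hn.1.pos
    have hM := primeProd_pos n
    set g : ℝ := 1 / ((n : ℝ) - 2) with hg_def
    set D : ℝ := ((n - 1).factorial * n : ℕ) * primeProd n
    have hD : 0 ≤ D := by positivity
    refine ⟨C + g / n * (n * D + C), by positivity, fun k X => ?_⟩
    have h1 := h k X
    have h2 := abs_mul_sum_ite_dvd_sub_le hn k X
    set A := ∑ m ∈ Finset.range X, smoothProd n (diffD k (2 * m))
    set S := ∑ m ∈ Finset.range X,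
      (if (n : ℤ) ∣ diffD k (2 * m) then smoothProd n (diffD k (2 * m)) else 0)
    have e1 : ∑ m ∈ Finset.range X, smoothProd (n + 1) (diffD k (2 * m)) = A + g * S := by
      simp only [smoothProd_succ_of_prime hn, Finset.sum_add_distrib, A, S, Finset.mul_sum,
        mul_ite, mul_zero, hg_def]
    have e2 : meanProd (n + 1) = (1 + g / n) * meanProd n := by
      rw [meanProd, oddPrimesBelow_succ_of_prime hn,
        Finset.prod_insert (self_notMem_oddPrimesBelow n), meanProd]
    have e3 : A + g * S - X * ((1 + g / n) * meanProd n) =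
        (A - X * meanProd n) + g / n * ((n * S - A) + (A - X * meanProd n)) := by
      field_simp
      ring
    rw [e1, e2, e3]
    refine (abs_add_le _ _).trans (add_le_add h1 ?_)
    rw [abs_mul, abs_of_nonneg (by positivity : 0 ≤ g / n)]
    exact mul_le_mul_of_nonneg_left ((abs_add_le _ _).trans (add_le_add h2 h1)) (by positivity)

/-! ### Averages over the pairs `(h, k₂)` -/

/-- The sum of `f k₂ h` over the even `h` with `1 ≤ h ≤ K - 1` and over `1 ≤ k₂ ≤ K - h`. -/
noncomputable def pairSum (K : ℕ) (f : ℕ → ℕ → ℝ) : ℝ :=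
  ∑ h ∈ Finset.Icc 1 (K - 1) with Even h, ∑ k ∈ Finset.Icc 1 (K - h), f k h

theorem pairSum_mono {K : ℕ} {f f' : ℕ → ℕ → ℝ}
    (h : ∀ k h, 1 ≤ k → 1 ≤ h → k + h ≤ K → f k h ≤ f' k h) : pairSum K f ≤ pairSum K f' := by
  refine Finset.sum_le_sum fun a ha => Finset.sum_le_sum fun b hb => ?_
  have h1 := Finset.mem_Icc.1 (Finset.mem_filter.1 ha).1
  have h2 := Finset.mem_Icc.1 hb
  exact h b a h2.1 h1.1 (by omega)

theorem pairSum_add (K : ℕ) (f f' : ℕ → ℕ → ℝ) :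
    pairSum K (fun k h => f k h + f' k h) = pairSum K f + pairSum K f' := by
  simp only [pairSum, Finset.sum_add_distrib]

theorem pairSum_mul_left (K : ℕ) (c : ℝ) (f : ℕ → ℕ → ℝ) :
    pairSum K (fun k h => c * f k h) = c * pairSum K f := by
  simp only [pairSum, Finset.mul_sum]

theorem pairSum_sum (K : ℕ) (s : Finset ℕ) (f : ℕ → ℕ → ℕ → ℝ) :
    pairSum K (fun k h => ∑ p ∈ s, f p k h) = ∑ p ∈ s, pairSum K (f p) := by
  simp only [pairSum]
  rw [Finset.sum_comm]
  exact Finset.sum_congr rfl fun h _ => Finset.sum_comm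

theorem pairSum_eq_sum_range (K : ℕ) (f : ℕ → ℕ → ℝ) :
    pairSum K f = ∑ j ∈ Finset.range K, ∑ m ∈ Finset.Icc 1 (j / 2), f (K - j) (2 * m) := by
  have h1 : pairSum K f = ∑ j ∈ Finset.range K, ∑ h ∈ Finset.Icc 1 j with Even h, f (K - j) h := by
    rw [Finset.sum_comm' (t' := {h ∈ Finset.Icc 1 (K - 1) | Even h})
      (s' := fun h => Finset.Ico h K)]
    · refine Finset.sum_congr rfl fun h hh => ?_
      have := Finset.mem_Icc.1 (Finset.mem_filter.1 hh).1
      refine Finset.sum_nbij' (fun k => K - k) (fun j => K - j) ?_ ?_ ?_ ?_ ?_ <;>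
        simp only [Finset.mem_Icc, Finset.mem_Ico] <;> intro a ha
      · omega
      · omega
      · omega
      · omega
      · rw [Nat.sub_sub_self (by omega)]
    · intro j h
      simp only [Finset.mem_range, Finset.mem_filter, Finset.mem_Icc, Finset.mem_Ico]
      constructor
      · rintro ⟨h1, h2, h3⟩
        exact ⟨⟨h2.2, h1⟩, ⟨h2.1, by omega⟩, h3⟩
      · rintro ⟨⟨h1, h2⟩, h3, h4⟩
        exact ⟨h2, ⟨h3.1, h1⟩, h4⟩
  rw [h1]
  refine Finset.sum_congr rfl fun j _ => ?_
  refine Finset.sum_nbij' (fun h => h / 2) (fun m => 2 * m) ?_ ?_ ?_ ?_ ?_ <;>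
    simp only [Finset.mem_filter, Finset.mem_Icc, Nat.even_iff] <;> intro a ha
  · omega
  · omega
  · omega
  · omega
  · rw [show 2 * (a / 2) = a by omega]

theorem abs_sum_range_div_two_sub_le (K : ℕ) :
    |∑ j ∈ Finset.range K, ((j / 2 : ℕ) : ℝ) - (K : ℝ) ^ 2 / 4| ≤ (K : ℝ) := by
  have h : (K : ℝ) ^ 2 / 4 - K ≤ ∑ j ∈ Finset.range K, ((j / 2 : ℕ) : ℝ) ∧
      ∑ j ∈ Finset.range K, ((j / 2 : ℕ) : ℝ) ≤ (K : ℝ) ^ 2 / 4 := by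
    induction K with
    | zero => simp
    | succ n ih =>
      rw [Finset.sum_range_succ]
      have h1 : ((n / 2 : ℕ) : ℝ) ≤ (n : ℝ) / 2 := Nat.cast_div_le
      have h2 : (n : ℝ) / 2 - 1 / 2 ≤ ((n / 2 : ℕ) : ℝ) := by
        have : n ≤ 2 * (n / 2) + 1 := by omega
        have : (n : ℝ) ≤ 2 * ((n / 2 : ℕ) : ℝ) + 1 := by exact_mod_cast this
        linarith
      push_cast
      constructor <;> nlinarith [ih.1, ih.2]
  rw [abs_le]
  have hK : (0 : ℝ) ≤ K := Nat.cast_nonneg K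
  constructor <;> linarith [h.1, h.2]

theorem one_le_meanProd (z : ℕ) : 1 ≤ meanProd z := by
  refine Finset.one_le_prod (fun p hp => ?_)
  have := one_div_sub_two_pos (mem_oddPrimesBelow.1 hp).2.2
  have : 0 ≤ 1 / ((p : ℝ) - 2) / p := by positivity
  linarith

theorem exists_abs_pairSum_smoothProd_sub_le (z : ℕ) : ∃ C : ℝ, ∀ K : ℕ,
    |pairSum K (fun k h => smoothProd z (diffD k h)) - (K : ℝ) ^ 2 / 4 * meanProd z| ≤ C * K := by
  obtain ⟨C, hC, h⟩ := exists_abs_sum_smoothProd_sub_le z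
  have hW := zero_le_one.trans (one_le_meanProd z)
  set W := meanProd z
  have hM := (primeProd_pos z).le
  have hrow : ∀ k n : ℕ, |∑ m ∈ Finset.Icc 1 n, smoothProd z (diffD k (2 * m)) - n * W| ≤
      C + W + primeProd z := by
    intro k n
    have h1 := h k (n + 1)
    rw [Finset.range_eq_Ico, Finset.sum_eq_sum_Ico_succ_bot (Nat.succ_pos n)] at h1
    have h2 := smoothProd_nonneg z (diffD k (2 * 0))
    have h3 := smoothProd_le_primeProd z (diffD k (2 * 0))
    have h4 : Finset.Ico (0 + 1) (n + 1) = Finset.Icc 1 n := by ext; simp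
    rw [h4] at h1
    push_cast at h1
    rw [abs_le] at h1 ⊢
    constructor <;> linarith [h1.1, h1.2]
  refine ⟨C + W + primeProd z + W, fun K => ?_⟩
  rw [pairSum_eq_sum_range]
  have e : ∑ j ∈ Finset.range K, ∑ m ∈ Finset.Icc 1 (j / 2), smoothProd z (diffD (K - j) (2 * m)) -
      (K : ℝ) ^ 2 / 4 * W =
      ∑ j ∈ Finset.range K, (∑ m ∈ Finset.Icc 1 (j / 2), smoothProd z (diffD (K - j) (2 * m)) -
        ((j / 2 : ℕ) : ℝ) * W) +
      (∑ j ∈ Finset.range K, ((j / 2 : ℕ) : ℝ) - (K : ℝ) ^ 2 / 4) * W := by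
    rw [Finset.sum_sub_distrib, ← Finset.sum_mul]
    ring
  rw [e, add_mul (C + W + primeProd z)]
  refine (abs_add_le _ _).trans (add_le_add ?_ ?_)
  · refine (Finset.abs_sum_le_sum_abs _ _).trans
      ((Finset.sum_le_card_nsmul _ _ _ fun j _ => hrow (K - j) (j / 2)).trans_eq ?_)
    rw [Finset.card_range, nsmul_eq_mul, mul_comm]
  · rw [abs_mul, abs_of_nonneg hW, mul_comm W]
    exact mul_le_mul_of_nonneg_right (abs_sum_range_div_two_sub_le K) hW

theorem tendsto_pairSum_smoothProd (z : ℕ) :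
    Tendsto (fun K : ℕ => 1 / (K : ℝ) ^ 2 * pairSum K fun k h => smoothProd z (diffD k h)) atTop
      (𝓝 (meanProd z / 4)) := by
  obtain ⟨C, h⟩ := exists_abs_pairSum_smoothProd_sub_le z
  rw [tendsto_iff_norm_sub_tendsto_zero]
  refine squeeze_zero' (Eventually.of_forall fun _ => norm_nonneg _) ?_
    (tendsto_const_div_atTop_nhds_zero_nat C)
  filter_upwards [eventually_gt_atTop 0] with K hK
  have hK' : (0 : ℝ) < K := Nat.cast_pos.2 hK
  have h1 := h K
  set T := pairSum K fun k h => smoothProd z (diffD k h)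
  have e : 1 / (K : ℝ) ^ 2 * T - meanProd z / 4 =
      1 / (K : ℝ) ^ 2 * (T - (K : ℝ) ^ 2 / 4 * meanProd z) := by
    field_simp
  rw [e, Real.norm_eq_abs, abs_mul, abs_of_pos (by positivity)]
  calc 1 / (K : ℝ) ^ 2 * |T - (K : ℝ) ^ 2 / 4 * meanProd z| ≤ 1 / (K : ℝ) ^ 2 * (C * K) := by
        gcongr
    _ = C / K := by field_simp

theorem pairSum_ite_dvd_le {p K : ℕ} (hp : p.Prime ∧ 2 < p) (hpK : p ≤ K) :
    pairSum K (fun k h => if (p : ℤ) ∣ diffD k h then 1 else 0) ≤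
      3 * (K : ℝ) ^ 2 / (orderOf (2 : ZMod p) : ℝ) := by
  refine le_trans ?_ (sum_card_dvd_diffD_le hp hpK)
  have hnn : ∀ k h, (0 : ℝ) ≤ if (p : ℤ) ∣ diffD k h then 1 else 0 := fun k h => by
    split_ifs <;> norm_num
  simp only [Finset.card_filter, Nat.cast_sum, Nat.cast_ite, Nat.cast_one, Nat.cast_zero]
  calc pairSum K (fun k h => if (p : ℤ) ∣ diffD k h then 1 else 0)
      ≤ ∑ h ∈ Finset.Icc 1 (K - 1) with Even h,
          ∑ k ∈ Finset.Icc 1 K, if (p : ℤ) ∣ diffD k h then 1 else 0 :=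
        Finset.sum_le_sum fun h _ => Finset.sum_le_sum_of_subset_of_nonneg
          (Finset.Icc_subset_Icc_right (Nat.sub_le K h)) fun k _ _ => hnn k h
    _ ≤ _ := Finset.sum_le_sum_of_subset_of_nonneg
        ((Finset.filter_subset _ _).trans (Finset.Icc_subset_Icc_right (Nat.sub_le K 1)))
        fun h _ _ => Finset.sum_nonneg fun k _ => hnn k h

theorem pairSum_smoothProd_le {y K : ℕ} (hyK : y ≤ K) :
    pairSum K (fun k h => smoothProd K (diffD k h)) ≤
      pairSum K (fun k h => smoothProd y (diffD k h)) +
        3 * (K : ℝ) ^ 2 * ∑' p, romanovWeight (p + y) := by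
  have htail : ∑ p ∈ Finset.Ico y K, romanovWeight p ≤ ∑' p, romanovWeight (p + y) := by
    rw [Finset.sum_Ico_eq_sum_range]
    simp only [add_comm y]
    exact ((summable_nat_add_iff y).2 summable_romanovWeight).sum_le_tsum _
      fun p _ => romanovWeight_nonneg _
  refine (pairSum_mono fun k h _ _ _ => smoothProd_le_add_sum hyK (diffD k h)).trans ?_
  rw [pairSum_add, pairSum_sum]
  refine add_le_add le_rfl (le_trans ?_ (mul_le_mul_of_nonneg_left htail (by positivity)))
  rw [Finset.mul_sum]
  refine Finset.sum_le_sum fun p hp => ?_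
  by_cases h : p.Prime ∧ 2 < p
  · have hg := one_div_sub_two_pos h.2
    have hM := primeProd_pos p
    have e : (fun k h' => if (p.Prime ∧ 2 < p) ∧ (p : ℤ) ∣ diffD k h' then
        1 / ((p : ℝ) - 2) * primeProd p else 0) = fun k h' =>
        1 / ((p : ℝ) - 2) * primeProd p * if (p : ℤ) ∣ diffD k h' then 1 else 0 := by
      funext k h'
      simp [h]
    rw [e, pairSum_mul_left, romanovWeight, if_pos h]
    refine (mul_le_mul_of_nonneg_left (pairSum_ite_dvd_le h (Finset.mem_Ico.1 hp).2.le)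
      (by positivity)).trans_eq ?_
    ring
  · rw [romanovWeight, if_neg h, mul_zero]
    simp [pairSum, h]

/-! ### The prime factors of `d` that are large compared with `log d` -/

/-- The product `∏_{p ∣ d, p > 2} (1 + 1/(p-2))` in the singular series. -/
noncomputable def oddFactorProd (d : ℤ) : ℝ :=
  ∏ p ∈ d.natAbs.primeFactors with 2 < p, (1 + 1 / ((p : ℝ) - 2))

theorem singularSeries_eq (d : ℤ) : singularSeries d = 2 * twinPrimeConst * oddFactorProd d := rfl

theorem smoothProd_eq_prod_filter {d : ℤ} (hd : d ≠ 0) (z : ℕ) :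
    smoothProd z d =
      ∏ p ∈ ({p ∈ d.natAbs.primeFactors | 2 < p} : Finset ℕ) with p < z,
        (1 + 1 / ((p : ℝ) - 2)) := by
  rw [smoothProd]
  congr 1
  ext p
  simp only [Finset.mem_filter, mem_oddPrimesBelow, Nat.mem_primeFactors, Int.natCast_dvd, ne_eq,
    Int.natAbs_eq_zero]
  tauto

theorem smoothProd_mul_prod_eq {d : ℤ} (hd : d ≠ 0) (z : ℕ) :
    smoothProd z d * ∏ p ∈ ({p ∈ d.natAbs.primeFactors | 2 < p} : Finset ℕ) with ¬ p < z,
      (1 + 1 / ((p : ℝ) - 2)) = oddFactorProd d := by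
  rw [smoothProd_eq_prod_filter hd, Finset.prod_filter_mul_prod_filter_not, oddFactorProd]

theorem smoothProd_le_oddFactorProd {d : ℤ} (hd : d ≠ 0) (z : ℕ) :
    smoothProd z d ≤ oddFactorProd d := by
  rw [← smoothProd_mul_prod_eq hd z]
  refine le_mul_of_one_le_right (smoothProd_nonneg z d) (Finset.one_le_prod fun p hp => ?_)
  have := one_div_sub_two_pos (Finset.mem_filter.1 (Finset.mem_filter.1 hp).1).2
  linarith

/-- An integer below `2 ^ K` has at most `K log 2 / log K` prime factors that are at least `K`, and
each of these contributes a factor of at most `1 + 1/(K-2)`. -/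
theorem oddFactorProd_le {d : ℤ} (hd : d ≠ 0) {K : ℕ} (hK : 3 ≤ K) (hdK : d.natAbs < 2 ^ K) :
    oddFactorProd d ≤
      Real.exp (K * Real.log 2 / Real.log K * (1 / ((K : ℝ) - 2))) * smoothProd K d := by
  rw [← smoothProd_mul_prod_eq hd K, mul_comm]
  refine mul_le_mul_of_nonneg_right ?_ (smoothProd_nonneg K d)
  set S := ({p ∈ ({p ∈ d.natAbs.primeFactors | 2 < p} : Finset ℕ) | ¬ p < K} : Finset ℕ)
  have hS : ∀ p ∈ S, p ∈ d.natAbs.primeFactors ∧ K ≤ p := fun p hp => by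
    simp only [S, Finset.mem_filter, not_lt] at hp
    exact ⟨hp.1.1, hp.2⟩
  have hK3 : (3 : ℝ) ≤ K := by exact_mod_cast hK
  have hg : 0 < 1 / ((K : ℝ) - 2) := one_div_pos.2 (by linarith)
  have hlog : 0 < Real.log K := Real.log_pos (by linarith)
  have h1 : K ^ S.card ≤ 2 ^ K :=
    calc K ^ S.card ≤ ∏ p ∈ S, p := Finset.pow_card_le_prod _ _ _ fun p hp => (hS p hp).2
      _ ≤ d.natAbs := Nat.le_of_dvd (Int.natAbs_pos.2 hd) ((Finset.prod_dvd_prod_of_subset _ _ _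
          fun p hp => (hS p hp).1).trans (Nat.prod_primeFactors_dvd _))
      _ ≤ 2 ^ K := hdK.le
  have h2 : (S.card : ℝ) ≤ K * Real.log 2 / Real.log K := by
    rw [le_div_iff₀ hlog, ← Real.log_pow, ← Real.log_pow]
    refine Real.log_le_log (by positivity) ?_
    exact_mod_cast h1
  calc ∏ p ∈ S, (1 + 1 / ((p : ℝ) - 2)) ≤ ∏ _p ∈ S, Real.exp (1 / ((K : ℝ) - 2)) := by
        refine Finset.prod_le_prod (fun p hp => ?_) fun p hp => ?_
        · have := one_div_sub_two_pos (lt_of_lt_of_le hK (hS p hp).2)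
          linarith
        · have hp' : (K : ℝ) ≤ p := Nat.cast_le.2 (hS p hp).2
          have : 1 / ((p : ℝ) - 2) ≤ 1 / ((K : ℝ) - 2) :=
            one_div_le_one_div_of_le (by linarith) (by linarith)
          linarith [Real.add_one_le_exp (1 / ((K : ℝ) - 2))]
    _ = Real.exp (S.card * (1 / ((K : ℝ) - 2))) := by
        rw [Finset.prod_const, ← Real.exp_nat_mul]
    _ ≤ _ := by gcongr

theorem tendsto_exp_log_div_log :
    Tendsto (fun K : ℕ => Real.exp (K * Real.log 2 / Real.log K * (1 / ((K : ℝ) - 2)))) atTop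
      (𝓝 1) := by
  suffices h : Tendsto (fun K : ℕ => K * Real.log 2 / Real.log K * (1 / ((K : ℝ) - 2))) atTop
      (𝓝 0) by
    have h' := (Real.continuous_exp.tendsto 0).comp h
    rwa [Real.exp_zero] at h'
  have h1 : Tendsto (fun K : ℕ => 3 * Real.log 2 / Real.log K) atTop (𝓝 0) :=
    (Real.tendsto_log_atTop.comp tendsto_natCast_atTop_atTop).const_div_atTop _
  refine squeeze_zero' ?_ ?_ h1
  all_goals
    filter_upwards [eventually_ge_atTop 3] with K hK
    have hK3 : (3 : ℝ) ≤ K := by exact_mod_cast hK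
    have hlog : 0 < Real.log K := Real.log_pos (by linarith)
    have hlog2 : 0 < Real.log 2 := Real.log_pos (by norm_num)
    have hK2 : 0 < (K : ℝ) - 2 := by linarith
  · positivity
  · have : (K : ℝ) * (1 / ((K : ℝ) - 2)) ≤ 3 := by
      rw [mul_one_div, div_le_iff₀ hK2]
      linarith
    calc K * Real.log 2 / Real.log K * (1 / ((K : ℝ) - 2))
        = (K * (1 / ((K : ℝ) - 2))) * Real.log 2 / Real.log K := by ring
      _ ≤ _ := by gcongr

theorem diffD_pos {k h : ℕ} (hk : 1 ≤ k) (hh : 1 ≤ h) : 0 < diffD k h := by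
  have h1 : (h : ℤ) < 2 ^ h := by exact_mod_cast Nat.lt_two_pow_self
  have h2 : (2 : ℤ) ^ 1 ≤ 2 ^ k := pow_le_pow_right₀ (by norm_num) hk
  have h3 : (1 : ℤ) ≤ h := by exact_mod_cast hh
  rw [diffD]
  nlinarith

theorem diffD_natAbs_lt {k h K : ℕ} (hk : 1 ≤ k) (hh : 1 ≤ h) (hK : k + h ≤ K) :
    (diffD k h).natAbs < 2 ^ K := by
  have h1 : (0 : ℤ) < 2 ^ k := by positivity
  have h2 : (2 : ℤ) ^ (k + h) ≤ 2 ^ K := pow_le_pow_right₀ (by norm_num) hK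
  have h3 : diffD k h < 2 ^ K := by
    rw [diffD]
    rw [pow_add] at h2
    have h4 : (1 : ℤ) ≤ h := by exact_mod_cast hh
    nlinarith
  zify
  rwa [abs_of_pos (diffD_pos hk hh)]

/-! ### The twin prime constant -/

theorem tendsto_prod_twinPrimeConst :
    Tendsto (fun y : ℕ => ∏ p ∈ oddPrimesBelow y, (1 - 1 / ((p : ℝ) - 1) ^ 2)) atTop
      (𝓝 twinPrimeConst) := by
  have h := multipliable_twinPrimeConst.hasProd
  have h2 : HasProd ((fun p : ℕ => (1 - 1 / ((p : ℝ) - 1) ^ 2)) ∘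
      ((↑) : {p : ℕ | p.Prime ∧ 3 ≤ p} → ℕ)) twinPrimeConst := h
  rw [hasProd_subtype_iff_mulIndicator] at h2
  refine h2.tendsto_prod_nat.congr fun y => ?_
  rw [oddPrimesBelow, Finset.prod_filter]
  refine Finset.prod_congr rfl fun p _ => ?_
  simp only [Set.mulIndicator, Set.mem_ofPred_eq, Nat.succ_le_iff]

theorem meanProd_mul_prod (y : ℕ) :
    meanProd y * ∏ p ∈ oddPrimesBelow y, (1 - 1 / ((p : ℝ) - 1) ^ 2) = 1 := by
  rw [meanProd, ← Finset.prod_mul_distrib]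
  refine Finset.prod_eq_one fun p hp => ?_
  have hp3 : (2 : ℝ) < p := by exact_mod_cast (mem_oddPrimesBelow.1 hp).2.2
  have h1 : (p : ℝ) - 2 ≠ 0 := by linarith
  have h2 : (p : ℝ) - 1 ≠ 0 := by linarith
  have h3 : (p : ℝ) ≠ 0 := by linarith
  field_simp
  ring

/-- Comparison with `∏_{2 ≤ n ≤ N} (1 - 1/n²) = (1 + 1/N) / 2`. -/
theorem one_half_le_prod (y : ℕ) :
    (1 / 2 : ℝ) ≤ ∏ p ∈ oddPrimesBelow y, (1 - 1 / ((p : ℝ) - 1) ^ 2) := by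
  have key : ∀ n : ℕ, (1 / 2 : ℝ) * (1 + 1 / (n + 1)) ≤
      ∏ p ∈ oddPrimesBelow (n + 3), (1 - 1 / ((p : ℝ) - 1) ^ 2) := by
    intro n
    induction n with
    | zero =>
      have : oddPrimesBelow (0 + 3) = ∅ := by
        ext p
        simp only [mem_oddPrimesBelow, Finset.notMem_empty, iff_false]
        omega
      rw [this]
      norm_num
    | succ n ih =>
      have hn : (0 : ℝ) ≤ n := Nat.cast_nonneg n
      have hf : (1 / 2 : ℝ) * (1 + 1 / ((n + 1 : ℕ) + 1)) ≤
          (1 - 1 / (((n + 3 : ℕ) : ℝ) - 1) ^ 2) * ((1 / 2 : ℝ) * (1 + 1 / (n + 1))) := by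
        push_cast
        have e : (n : ℝ) + 3 - 1 = n + 2 := by ring
        rw [e]
        refine le_of_eq ?_
        field_simp
        ring
      by_cases h : (n + 3).Prime ∧ 2 < n + 3
      · rw [show n + 1 + 3 = n + 3 + 1 by ring, oddPrimesBelow_succ_of_prime h,
          Finset.prod_insert (self_notMem_oddPrimesBelow _)]
        refine hf.trans (mul_le_mul_of_nonneg_left ih ?_)
        push_cast
        rw [sub_nonneg, div_le_one (by nlinarith)]
        nlinarith
      · rw [show n + 1 + 3 = n + 3 + 1 by ring, oddPrimesBelow_succ_of_not_prime h]
        refine le_trans ?_ ih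
        push_cast
        gcongr
        linarith
  rcases le_total 3 y with hy | hy
  · obtain ⟨n, rfl⟩ := Nat.exists_eq_add_of_le' hy
    refine le_trans ?_ (key n)
    have : (0 : ℝ) ≤ 1 / (n + 1) := by positivity
    linarith
  · have : oddPrimesBelow y = ∅ := by
      ext p
      simp only [mem_oddPrimesBelow, Finset.notMem_empty, iff_false]
      omega
    rw [this]
    norm_num

theorem twinPrimeConst_pos : 0 < twinPrimeConst :=
  (by norm_num : (0 : ℝ) < 1 / 2).trans_le
    (ge_of_tendsto' tendsto_prod_twinPrimeConst one_half_le_prod)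

theorem tendsto_twinPrimeConst_mul_meanProd :
    Tendsto (fun y => twinPrimeConst * meanProd y) atTop (𝓝 1) := by
  have h := (tendsto_prod_twinPrimeConst.inv₀ twinPrimeConst_pos.ne').const_mul twinPrimeConst
  rw [mul_inv_cancel₀ twinPrimeConst_pos.ne'] at h
  refine h.congr fun y => ?_
  rw [← eq_inv_of_mul_eq_one_left (meanProd_mul_prod y)]

/-! ### The limit of the mean value -/

theorem tendsto_pairSum_singularSeries :
    Tendsto (fun K : ℕ => 1 / (K : ℝ) ^ 2 * pairSum K fun k h => singularSeries (diffD k h)) atTop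
      (𝓝 (1 / 2)) := by
  have hC := twinPrimeConst_pos
  have htail : Tendsto (fun y : ℕ => ∑' p, romanovWeight (p + y)) atTop (𝓝 0) :=
    tendsto_sum_nat_add romanovWeight
  refine tendsto_order.2 ⟨fun a ha => ?_, fun a ha => ?_⟩
  · have h1 : Tendsto (fun y => 2 * twinPrimeConst * (meanProd y / 4)) atTop (𝓝 (1 / 2)) := by
      have := tendsto_twinPrimeConst_mul_meanProd.const_mul (1 / 2)
      rw [mul_one] at this
      exact this.congr fun y => by ring
    obtain ⟨y, hy⟩ := (h1.eventually_const_lt ha).exists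
    have h2 := (tendsto_pairSum_smoothProd y).const_mul (2 * twinPrimeConst)
    filter_upwards [h2.eventually_const_lt hy] with K hK
    refine hK.trans_le ?_
    rw [mul_left_comm, ← pairSum_mul_left]
    refine mul_le_mul_of_nonneg_left (pairSum_mono fun k h hk hh _ => ?_) (by positivity)
    rw [singularSeries_eq]
    exact mul_le_mul_of_nonneg_left (smoothProd_le_oddFactorProd (diffD_pos hk hh).ne' y)
      (by positivity)
  · have h1 : Tendsto (fun y => 2 * twinPrimeConst *
        (1 * (meanProd y / 4 + 3 * ∑' p, romanovWeight (p + y)))) atTop (𝓝 (1 / 2)) := by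
      have := (tendsto_twinPrimeConst_mul_meanProd.const_mul (1 / 2)).add
        (htail.const_mul (6 * twinPrimeConst))
      rw [mul_one, mul_zero, add_zero] at this
      exact this.congr fun y => by ring
    obtain ⟨y, hy⟩ := (h1.eventually_lt_const ha).exists
    have h2 := (tendsto_exp_log_div_log.mul ((tendsto_pairSum_smoothProd y).add_const
      (3 * ∑' p, romanovWeight (p + y)))).const_mul (2 * twinPrimeConst)
    filter_upwards [h2.eventually_lt_const hy, eventually_ge_atTop y, eventually_ge_atTop 3]
      with K hK hyK hK3
    refine lt_of_le_of_lt ?_ hK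
    have hK0 : (K : ℝ) ≠ 0 := by positivity
    set E := Real.exp (K * Real.log 2 / Real.log K * (1 / ((K : ℝ) - 2)))
    have h3 : pairSum K (fun k h => singularSeries (diffD k h)) ≤
        2 * twinPrimeConst * E * pairSum K (fun k h => smoothProd K (diffD k h)) := by
      rw [← pairSum_mul_left]
      refine pairSum_mono fun k h hk hh hkh => ?_
      rw [singularSeries_eq, mul_assoc (2 * twinPrimeConst)]
      exact mul_le_mul_of_nonneg_left (oddFactorProd_le (diffD_pos hk hh).ne' hK3
        (diffD_natAbs_lt hk hh hkh)) (by positivity)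
    have hE : 0 < E := Real.exp_pos _
    calc 1 / (K : ℝ) ^ 2 * pairSum K (fun k h => singularSeries (diffD k h))
        ≤ 1 / (K : ℝ) ^ 2 * (2 * twinPrimeConst * E *
          (pairSum K (fun k h => smoothProd y (diffD k h)) +
            3 * (K : ℝ) ^ 2 * ∑' p, romanovWeight (p + y))) := by
          refine mul_le_mul_of_nonneg_left (h3.trans ?_) (by positivity)
          exact mul_le_mul_of_nonneg_left (pairSum_smoothProd_le hyK) (by positivity)
      _ = _ := by
          field_simp

theorem tendsto_paramK : Tendsto paramK atTop atTop := by
  have h1 : Tendsto (fun x : ℝ => x / Real.log x ^ 2) atTop atTop := by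
    have h := (Real.isLittleO_pow_log_id_atTop (n := 2)).tendsto_div_nhds_zero
    have h' : Tendsto (fun x : ℝ => Real.log x ^ 2 / id x) atTop (𝓝[>] 0) := by
      refine tendsto_nhdsWithin_iff.2 ⟨h, ?_⟩
      filter_upwards [eventually_gt_atTop 1] with x hx
      have := Real.log_pos hx
      exact div_pos (pow_pos this 2) (zero_lt_one.trans hx)
    exact h'.inv_tendsto_nhdsGT_zero.congr fun x => by simp
  have h2 := (Real.tendsto_logb_atTop (b := 2) (by norm_num)).comp h1
  have h3 := tendsto_nat_floor_atTop.comp (h2.comp tendsto_natCast_atTop_atTop)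
  refine h3.congr' ?_
  filter_upwards [eventually_gt_atTop 1] with N hN
  have hN1 : (1 : ℝ) < N := by exact_mod_cast hN
  have hlog := Real.log_pos hN1
  simp only [Function.comp_apply, paramK]
  rw [Real.logb_div (by linarith) (by positivity), Real.logb_pow]
  norm_num

theorem tendsto_meanPhi : Tendsto meanPhi atTop (𝓝 (1 / 2)) :=
  tendsto_pairSum_singularSeries.comp tendsto_paramK

theorem theorem1p1 :
    Summable romanovTerm ∧
    ((1 / 2 : ℝ) : EReal) ≤ liminf (fun N : ℕ => ((meanPhi N : ℝ) : EReal)) atTop ∧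
    liminf (fun N : ℕ => ((meanPhi N : ℝ) : EReal)) atTop ≤
      limsup (fun N : ℕ => ((meanPhi N : ℝ) : EReal)) atTop ∧
    limsup (fun N : ℕ => ((meanPhi N : ℝ) : EReal)) atTop ≤
      (((romanovConst + Real.exp Real.eulerMascheroniConstant * Real.log 2) / 2 : ℝ) : EReal) := by
  have h : Tendsto (fun N : ℕ => ((meanPhi N : ℝ) : EReal)) atTop (𝓝 ((1 / 2 : ℝ) : EReal)) :=
    (continuous_coe_real_ereal.tendsto _).comp tendsto_meanPhi
  refine ⟨summable_romanovTerm, h.liminf_eq.ge, liminf_le_limsup, h.limsup_eq.trans_le ?_⟩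
  have h1 := one_le_romanovConst
  have h2 : 0 ≤ Real.exp Real.eulerMascheroniConstant * Real.log 2 :=
    mul_nonneg (Real.exp_pos _).le (Real.log_nonneg (by norm_num))
  exact EReal.coe_le_coe_iff.2 (by linarith)
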